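/- Let $E_u$ be a Dedekind complete Riesz space with a strong unit $u$ (that is, $u \ge 0$ and for every $x \in E_u$ there is a real $c$ with $|x| \le c\,u$). Then there is exactly one multiplication on $E_u$ that makes it an $f$-algebra with algebra unit $u$. For this multiplication, put $x^0 = u$. For every $x \in E_u$ the sequence $\sum_{k=0}^n \frac{1}{k!}x^k$ converges in order; denote its order limit by $\exp(x)$. Moreover: 1. For all $x, y \in E_u$ there is a positive invertible element $z \in E_u$ (that is, $z \ge 0$ and $zw = wz = u$ for some $w \in E_u$) such that $$\exp(x) - \exp(y) = z\,(x - y).$$ 2. For all $x, y \in E_u$ and every real $\lambda > 0$, the band generated by $(x-y)^+$ is a projection band and is equal to the band generated by $(\exp(\lambda x) - \exp(\lambda y))^+$. In particular, with $\lambda = 1$, the bands generated by $(x-y)^+$ and by $(\exp x - \exp y)^+$ are equal. -/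

import Mathlib

/-! Riesz spaces: a real vector space with a lattice order compatible with the linear structure.
`ConditionallyCompleteLattice` expresses Dedekind completeness. -/

noncomputable section

namespace RieszSpace

section Order

variable {E : Type*} [AddCommGroup E] [Lattice E] [Module ℝ E]

/-- `u` is a strong (order) unit: `u ≥ 0` and every element is dominated in absolute value by a
real multiple of `u`, i.e. the order ideal generated by `u` is the whole space. -/
structure IsStrongUnit (u : E) : Prop where
  nonneg : 0 ≤ u
  dominates : ∀ x : E, ∃ c : ℝ, |x| ≤ c • u

/-- Order convergence of a sequence: `|s n - a| ≤ p n` for some sequence `p` decreasing to `0`. -/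
def OrderTendsto (s : ℕ → E) (a : E) : Prop :=
  ∃ p : ℕ → E, Antitone p ∧ IsGLB (Set.range p) 0 ∧ ∀ n, |s n - a| ≤ p n

/-- A band: a linear subspace which is solid (so an order ideal) and contains the supremum of each
of its subsets whenever that supremum exists in the ambient space. -/
structure IsBand (B : Submodule ℝ E) : Prop where
  solid : ∀ ⦃x y : E⦄, x ∈ B → |y| ≤ |x| → y ∈ B
  isLUB_mem : ∀ ⦃S : Set E⦄ ⦃a : E⦄, S ⊆ (B : Set E) → IsLUB S a → a ∈ B

/-- The band generated by `w`: the smallest band containing `w`. -/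
def bandGenerated (w : E) : Submodule ℝ E :=
  sInf {B : Submodule ℝ E | IsBand B ∧ w ∈ B}

/-- A projection band: a band `B` such that every element is the sum of an element of `B` and an
element of the disjoint complement of `B`. -/
structure IsProjectionBand (B : Submodule ℝ E) : Prop where
  isBand : IsBand B
  decompose : ∀ x : E, ∃ y ∈ B, ∃ z : E, (∀ b ∈ B, |z| ⊓ |b| = 0) ∧ x = y + z

/-- A bilinear multiplication making the Riesz space an `f`-algebra with algebra unit `u`. -/
structure IsUnitalFAlgebraMul (u : E) (m : E →ₗ[ℝ] E →ₗ[ℝ] E) : Prop where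
  assoc : ∀ x y z : E, m (m x y) z = m x (m y z)
  unit_mul : ∀ x : E, m u x = x
  mul_unit : ∀ x : E, m x u = x
  mul_nonneg : ∀ x y : E, 0 ≤ x → 0 ≤ y → 0 ≤ m x y
  mul_left_disjoint : ∀ x y c : E, x ⊓ y = 0 → 0 ≤ c → m c x ⊓ y = 0
  mul_right_disjoint : ∀ x y c : E, x ⊓ y = 0 → 0 ≤ c → m x c ⊓ y = 0

/-- Powers for the multiplication `m`, with `x ^ 0 = u`. -/
def pow (u : E) (m : E →ₗ[ℝ] E →ₗ[ℝ] E) (x : E) : ℕ → E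
  | 0 => u
  | n + 1 => m x (pow u m x n)

/-- The partial sums `∑ k ≤ n, x ^ k / k!`. -/
def expPartialSum (u : E) (m : E →ₗ[ℝ] E →ₗ[ℝ] E) (x : E) (n : ℕ) : E :=
  ∑ k ∈ Finset.range (n + 1), ((k.factorial : ℝ)⁻¹) • pow u m x k

open Classical in
/-- The exponential: the order limit of the exponential partial sums (and `0` if there is none). -/
def exp (u : E) (m : E →ₗ[ℝ] E →ₗ[ℝ] E) (x : E) : E :=
  if h : ∃ e : E, OrderTendsto (expPartialSum u m x) e then h.choose else 0

end Order

end RieszSpace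

end

set_option linter.unusedSectionVars false

namespace RieszSpace

/-! ### Order ideals and the real homomorphisms obtained from maximal ones. -/

section Preliminaries

variable {E : Type*} [AddCommGroup E] [Lattice E] [IsOrderedAddMonoid E] [Module ℝ E]
  [IsOrderedModule ℝ E]

/-! The space behaves like `C(K)`, with the unital Riesz homomorphisms `φ : E → ℝ` as the points of
`K`. Zorn's lemma supplies enough maximal ideals for these `φ` to determine the order
(`nonneg_of_forall_unitalHom`), so every identity or inequality can be checked on real numbers.

Dedekind completeness realises uniform limits (`exists_of_forall_approx`); with the lattice form of
Stone–Weierstrass this gives a continuous functional calculus (`exists_map_eq_comp`). Squares and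
polarization then give the product. Uniqueness holds because each `φ` is multiplicative for any
admissible product (`map_mul`).

Under `φ` the exponential becomes the real one, so `exp x - exp y = exp y · D(x - y) · (x - y)`,
where `D(t) = (e^t - 1)/t`, `D(0) = 1`, is continuous and positive. Multiplying by a positive
element with positive inverse changes positive parts only within scalar bounds, hence preserves the
bands they generate. Every band is a projection band by completeness. -/

theorem abs_smul_le (c : ℝ) (x : E) : |c • x| ≤ |c| • |x| := by
  have key : ∀ y : E, c • y ≤ |c| • |y| := fun y => by
    rcases le_total 0 c with hc | hc
    · rw [abs_of_nonneg hc]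
      exact smul_le_smul_of_nonneg_left (le_abs_self y) hc
    · rw [abs_of_nonpos hc, ← neg_smul_neg]
      exact smul_le_smul_of_nonneg_left (neg_le_abs y) (neg_nonneg.2 hc)
  refine abs_le'.2 ⟨key x, ?_⟩
  simpa using key (-x)

theorem abs_smul_of_nonneg {c : ℝ} (hc : 0 ≤ c) {x : E} (hx : 0 ≤ x) : |c • x| = c • x :=
  abs_of_nonneg (smul_nonneg hc hx)

/-- A solid linear subspace, i.e. an order ideal of the Riesz space. -/
def IsOrderIdeal (I : Submodule ℝ E) : Prop :=
  ∀ ⦃x y : E⦄, x ∈ I → |y| ≤ |x| → y ∈ I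

/-- The order ideal generated by an order ideal `I` and a positive element `a`. -/
def adjoin (I : Submodule ℝ E) (a : E) : Submodule ℝ E where
  carrier := {y | ∃ i ∈ I, 0 ≤ i ∧ ∃ r : ℝ, 0 ≤ r ∧ |y| ≤ i + r • a}
  zero_mem' := ⟨0, I.zero_mem, le_rfl, 0, le_rfl, by simp⟩
  add_mem' := by
    rintro x y ⟨i, hi, hi0, r, hr, hx⟩ ⟨j, hj, hj0, s, hs, hy⟩
    refine ⟨i + j, I.add_mem hi hj, add_nonneg hi0 hj0, r + s, add_nonneg hr hs, ?_⟩
    calc |x + y| ≤ |x| + |y| := abs_add_le x y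
      _ ≤ (i + r • a) + (j + s • a) := add_le_add hx hy
      _ = _ := by rw [add_smul]; abel
  smul_mem' := by
    rintro c x ⟨i, hi, hi0, r, hr, hx⟩
    refine ⟨|c| • i, I.smul_mem _ hi, smul_nonneg (abs_nonneg c) hi0, |c| * r,
      mul_nonneg (abs_nonneg c) hr, (abs_smul_le c x).trans ?_⟩
    rw [mul_smul, ← smul_add]
    exact smul_le_smul_of_nonneg_left hx (abs_nonneg c)

theorem isOrderIdeal_adjoin (I : Submodule ℝ E) (a : E) :
    IsOrderIdeal (adjoin I a) := by
  rintro x y ⟨i, hi, hi0, r, hr, hx⟩ hyx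
  exact ⟨i, hi, hi0, r, hr, hyx.trans hx⟩

theorem IsOrderIdeal.abs_mem {I : Submodule ℝ E} (hI : IsOrderIdeal I) {x : E} (hx : x ∈ I) :
    |x| ∈ I := hI hx (by rw [abs_abs])

theorem IsOrderIdeal.mem_of_le {I : Submodule ℝ E} (hI : IsOrderIdeal I) {x y : E} (hx : x ∈ I)
    (hx0 : 0 ≤ x) (hy : |y| ≤ x) : y ∈ I := hI hx (by rwa [abs_of_nonneg hx0])

theorem le_adjoin {I : Submodule ℝ E} (hI : IsOrderIdeal I) (a : E) :
    I ≤ adjoin I a := fun x hx =>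
  ⟨|x|, hI.abs_mem hx, abs_nonneg x, 0, le_rfl, by simp⟩

theorem mem_adjoin_self (I : Submodule ℝ E) {a : E} (ha : 0 ≤ a) :
    a ∈ adjoin I a :=
  ⟨0, I.zero_mem, le_rfl, 1, zero_le_one, by simp [abs_of_nonneg ha]⟩

/-- The elements that are within `I + ε u` for every `ε > 0`. -/
def uniformClosure (I : Submodule ℝ E) {u : E} (hu : 0 ≤ u) : Submodule ℝ E where
  carrier := {y | ∀ ε : ℝ, 0 < ε → ∃ i ∈ I, 0 ≤ i ∧ |y| ≤ i + ε • u}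
  zero_mem' := fun _ hε =>
    ⟨0, I.zero_mem, le_rfl, by simpa using smul_nonneg hε.le hu⟩
  add_mem' := by
    intro x y hx hy ε hε
    obtain ⟨i, hi, hi0, hx⟩ := hx (ε / 2) (half_pos hε)
    obtain ⟨j, hj, hj0, hy⟩ := hy (ε / 2) (half_pos hε)
    refine ⟨i + j, I.add_mem hi hj, add_nonneg hi0 hj0, ?_⟩
    calc |x + y| ≤ |x| + |y| := abs_add_le x y
      _ ≤ (i + (ε / 2) • u) + (j + (ε / 2) • u) := add_le_add hx hy
      _ = i + j + (ε / 2 + ε / 2) • u := by rw [add_smul]; abel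
      _ = _ := by rw [add_halves]
  smul_mem' := by
    intro c x hx ε hε
    have hc : 0 < |c| + 1 := by positivity
    obtain ⟨i, hi, hi0, hx⟩ := hx (ε / (|c| + 1)) (by positivity)
    refine ⟨(|c| + 1) • i, I.smul_mem _ hi, smul_nonneg hc.le hi0, ?_⟩
    calc |c • x| ≤ |c| • |x| := abs_smul_le c x
      _ ≤ (|c| + 1) • |x| := smul_le_smul_of_nonneg_right (by linarith) (abs_nonneg x)
      _ ≤ (|c| + 1) • (i + (ε / (|c| + 1)) • u) := smul_le_smul_of_nonneg_left hx hc.le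
      _ = _ := by rw [smul_add, smul_smul, mul_div_cancel₀ _ hc.ne']

theorem isOrderIdeal_uniformClosure (I : Submodule ℝ E) {u : E} (hu : 0 ≤ u) :
    IsOrderIdeal (uniformClosure I hu) := by
  intro x y hx hyx ε hε
  obtain ⟨i, hi, hi0, h⟩ := hx ε hε
  exact ⟨i, hi, hi0, hyx.trans h⟩

theorem le_uniformClosure {I : Submodule ℝ E} (hI : IsOrderIdeal I) {u : E} (hu : 0 ≤ u) :
    I ≤ uniformClosure I hu := fun x hx _ hε =>
  ⟨|x|, hI.abs_mem hx, abs_nonneg x, le_add_of_nonneg_right (smul_nonneg hε.le hu)⟩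

theorem notMem_uniformClosure {I : Submodule ℝ E} (hI : IsOrderIdeal I) {u : E} (hu : 0 ≤ u)
    (hI' : u ∉ I) : u ∉ uniformClosure I hu := by
  intro h
  obtain ⟨i, hi, hi0, h⟩ := h 2⁻¹ (by norm_num)
  rw [abs_of_nonneg hu] at h
  have h2 : (2 : ℝ)⁻¹ • u ≤ i := by
    have h3 : u = (2 : ℝ)⁻¹ • u + (2 : ℝ)⁻¹ • u := by rw [← add_smul]; norm_num
    nth_rw 1 [h3] at h
    exact le_of_add_le_add_right h
  have h4 : (2 : ℝ)⁻¹ • u ∈ I :=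
    hI.mem_of_le hi hi0 (by rwa [abs_smul_of_nonneg (by norm_num) hu])
  exact hI' (by simpa using I.smul_mem 2 h4)

/-- The proper order ideals with respect to `u`. -/
def properIdeals (u : E) : Set (Submodule ℝ E) := {I | IsOrderIdeal I ∧ u ∉ I}

theorem exists_maximal_ideal {u : E} {I : Submodule ℝ E} (hI : I ∈ properIdeals u) :
    ∃ M, I ≤ M ∧ Maximal (· ∈ properIdeals u) M := by
  refine zorn_le_nonempty₀ _ (fun c hc hchain J hJ => ?_) I hI
  have hmem : ∀ x, x ∈ sSup c ↔ ∃ K ∈ c, x ∈ K := fun x =>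
    Submodule.mem_sSup_of_directed ⟨J, hJ⟩ hchain.directedOn
  refine ⟨sSup c, ⟨fun x y hx hyx => ?_, fun hu => ?_⟩, fun K hK => le_sSup hK⟩
  · obtain ⟨K, hK, hxK⟩ := (hmem x).1 hx
    exact (hmem y).2 ⟨K, hK, (hc hK).1 hxK hyx⟩
  · obtain ⟨K, hK, huK⟩ := (hmem u).1 hu
    exact (hc hK).2 huK

theorem inf_add_le_add_inf {a b c : E} (ha : 0 ≤ a) (hb : 0 ≤ b) (hc : 0 ≤ c) :
    (a + b) ⊓ c ≤ a ⊓ c + b ⊓ c := by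
  rw [add_inf, inf_add, inf_add]
  refine le_inf (le_inf inf_le_left ?_) (le_inf ?_ ?_)
  · exact inf_le_right.trans (le_add_of_nonneg_right hb)
  · exact inf_le_right.trans (le_add_of_nonneg_left ha)
  · exact inf_le_right.trans (le_add_of_nonneg_left hc)

theorem smul_inf_smul_eq_zero {a b : E} (hab : a ⊓ b = 0) {r s : ℝ} (hr : 0 ≤ r) (hs : 0 ≤ s) :
    r • a ⊓ s • b = 0 := by
  have ha : 0 ≤ a := hab ▸ inf_le_left
  have hb : 0 ≤ b := hab ▸ inf_le_right
  refine le_antisymm ?_ (le_inf (smul_nonneg hr ha) (smul_nonneg hs hb))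
  have hk : 0 < r + s + 1 := by positivity
  have h1 : (r + s + 1)⁻¹ • (r • a ⊓ s • b) ≤ a ⊓ b := by
    have key : ∀ (t : ℝ) (x y : E), t ≤ r + s + 1 → 0 ≤ x → y ≤ t • x →
        (r + s + 1)⁻¹ • y ≤ x := fun t x y ht hx hy => by
      calc (r + s + 1)⁻¹ • y ≤ (r + s + 1)⁻¹ • ((r + s + 1) • x) :=
            smul_le_smul_of_nonneg_left (hy.trans (smul_le_smul_of_nonneg_right ht hx))
              (inv_nonneg.2 hk.le)
        _ = x := inv_smul_smul₀ hk.ne' x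
    exact le_inf (key r _ _ (by linarith) ha inf_le_left) (key s _ _ (by linarith) hb inf_le_right)
  rw [hab] at h1
  simpa [smul_smul, hk.ne'] using smul_le_smul_of_nonneg_left h1 hk.le

/-- Maximal ideals are prime: if both elements were outside `M`, then `u ≤ i + r • a` and `u ≤ j + s
• b` with `i, j ∈ M`. Taking the infimum kills the disjoint parts and forces `u ∈ M`. -/
theorem mem_or_mem_of_inf_eq_zero {u : E} (hu : 0 ≤ u) {M : Submodule ℝ E}
    (hM : Maximal (· ∈ properIdeals u) M) {a b : E} (hab : a ⊓ b = 0) : a ∈ M ∨ b ∈ M := by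
  have ha : 0 ≤ a := hab ▸ inf_le_left
  have hb : 0 ≤ b := hab ▸ inf_le_right
  have key : ∀ c : E, 0 ≤ c → c ∉ M → ∃ i ∈ M, 0 ≤ i ∧ ∃ r : ℝ, 0 ≤ r ∧ u ≤ i + r • c := by
    intro c hc hcM
    have h : u ∈ adjoin M c := by
      by_contra h
      exact hcM (hM.2 ⟨isOrderIdeal_adjoin M c, h⟩ (le_adjoin hM.1.1 c) (mem_adjoin_self M hc))
    obtain ⟨i, hi, hi0, r, hr, h⟩ := h
    exact ⟨i, hi, hi0, r, hr, by rwa [abs_of_nonneg hu] at h⟩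
  by_contra! h
  obtain ⟨i, hi, hi0, r, hr, h1⟩ := key a ha h.1
  obtain ⟨j, hj, hj0, s, hs, h2⟩ := key b hb h.2
  refine hM.1.2 (hM.1.1.mem_of_le (M.add_mem hi hj) (add_nonneg hi0 hj0) ?_)
  rw [abs_of_nonneg hu]
  have hij : 0 ≤ i + j := add_nonneg hi0 hj0
  have h3 : u ≤ (i + j + r • a) ⊓ (i + j + s • b) := by
    refine le_inf (h1.trans ?_) (h2.trans ?_)
    · rw [add_right_comm]
      exact le_add_of_nonneg_right hj0
    · rw [add_assoc]
      exact le_add_of_nonneg_left hi0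
  rwa [← add_inf, smul_inf_smul_eq_zero hab hr hs, add_zero] at h3

/-- A unital Riesz homomorphism into the real numbers. -/
structure IsUnitalHom (u : E) (φ : E →ₗ[ℝ] ℝ) : Prop where
  map_unit : φ u = 1
  map_abs : ∀ x, φ |x| = |φ x|

/-- The quotient by `M` is one-dimensional. The scalar is the cut `inf {t | (x - t • u)⁺ ∈ M}`;
membership holds only up to every `ε • u`, which suffices since maximality makes `M` uniformly
closed. -/
theorem exists_sub_smul_mem {u : E} (hu : IsStrongUnit u) {M : Submodule ℝ E}
    (hM : Maximal (· ∈ properIdeals u) M) (x : E) : ∃ t : ℝ, x - t • u ∈ M := by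
  have hideal := hM.1.1
  have hcl : uniformClosure M hu.nonneg ≤ M :=
    hM.2 ⟨isOrderIdeal_uniformClosure M hu.nonneg, notMem_uniformClosure hideal hu.nonneg hM.1.2⟩
      (le_uniformClosure hideal hu.nonneg)
  set S : Set ℝ := {t | (x - t • u)⁺ ∈ M}
  obtain ⟨c, hc⟩ := hu.dominates x
  have hne : S.Nonempty := ⟨c, by
    have : (x - c • u)⁺ = 0 := posPart_eq_zero.2 (sub_nonpos.2 ((le_abs_self x).trans hc))
    change _ ∈ M
    rw [this]
    exact M.zero_mem⟩
  have hbdd : BddBelow S := by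
    refine ⟨-c, fun t ht => ?_⟩
    by_contra! hlt
    have h1 : (-c - t) • u ≤ (x - t • u)⁺ := by
      refine le_trans ?_ (le_posPart _)
      rw [sub_smul, neg_smul]
      exact sub_le_sub_right (neg_le.1 ((neg_le_abs x).trans hc)) _
    have hpos : 0 < -c - t := by linarith
    have h2 : (-c - t) • u ∈ M := hideal.mem_of_le ht (posPart_nonneg _)
      (by rwa [abs_smul_of_nonneg hpos.le hu.nonneg])
    exact hM.1.2 (by simpa [smul_smul, hpos.ne'] using M.smul_mem (-c - t)⁻¹ h2)
  refine ⟨sInf S, hcl fun ε hε => ?_⟩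
  set t := sInf S with ht
  have hplus : (x - (t + ε) • u)⁺ ∈ M := by
    obtain ⟨s, hs, hst⟩ := exists_lt_of_csInf_lt hne (show sInf S < t + ε by linarith)
    refine hideal.mem_of_le hs (posPart_nonneg _) ?_
    rw [abs_of_nonneg (posPart_nonneg _)]
    exact posPart_mono (sub_le_sub_left (smul_le_smul_of_nonneg_right hst.le hu.nonneg) _)
  -- Below the cut the positive part is not in `M`, so primality puts the negative part there.
  have hminus : (x - (t - ε) • u)⁻ ∈ M := by
    refine (mem_or_mem_of_inf_eq_zero hu.nonneg hM
      (posPart_inf_negPart_eq_zero (x - (t - ε) • u))).resolve_left fun h => ?_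
    have := csInf_le hbdd (show t - ε ∈ S from h)
    linarith
  refine ⟨_, M.add_mem hplus hminus, add_nonneg (posPart_nonneg _) (negPart_nonneg _), ?_⟩
  refine abs_le'.2 ⟨?_, ?_⟩
  · calc x - t • u = x - (t + ε) • u + ε • u := by rw [add_smul]; abel
      _ ≤ (x - (t + ε) • u)⁺ + ε • u := add_le_add_left (le_posPart _) _
      _ ≤ _ := add_le_add_left (le_add_of_nonneg_right (negPart_nonneg _)) _
  · calc -(x - t • u) = -(x - (t - ε) • u) + ε • u := by rw [sub_smul]; abel
      _ ≤ (x - (t - ε) • u)⁻ + ε • u := add_le_add_left (neg_le_negPart _) _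
      _ ≤ _ := add_le_add_left (le_add_of_nonneg_left (posPart_nonneg _)) _

theorem exists_unitalHom_of_maximal {u : E} (hu : IsStrongUnit u) {M : Submodule ℝ E}
    (hM : Maximal (· ∈ properIdeals u) M) :
    ∃ φ : E →ₗ[ℝ] ℝ, IsUnitalHom u φ ∧ ∀ x, x - φ x • u ∈ M := by
  choose f hf using exists_sub_smul_mem hu hM
  have huniq : ∀ x (t : ℝ), x - t • u ∈ M → f x = t := by
    intro x t ht
    by_contra hne
    have h1 := M.sub_mem ht (hf x)
    have h2 : x - t • u - (x - f x • u) = (f x - t) • u := by rw [sub_smul]; abel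
    rw [h2] at h1
    exact hM.1.2 (by simpa [smul_smul, sub_ne_zero.2 hne] using M.smul_mem (f x - t)⁻¹ h1)
  refine ⟨⟨⟨f, fun x y => huniq _ _ ?_⟩, fun c x => huniq _ _ ?_⟩, ⟨huniq _ _ ?_, fun x => huniq _ _ ?_⟩,
    hf⟩
  · have := M.add_mem (hf x) (hf y)
    rwa [sub_add_sub_comm, ← add_smul] at this
  · have := M.smul_mem c (hf x)
    rwa [smul_sub, smul_smul] at this
  · simp
  · refine hM.1.1 (hf x) ?_
    have h : |f x| • u = |f x • u| := by
      refine le_antisymm ?_ ((abs_smul_le _ _).trans_eq (by rw [abs_of_nonneg hu.nonneg]))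
      rcases abs_choice (f x) with h | h <;> rw [h]
      · exact le_abs_self _
      · rw [neg_smul]
        exact neg_le_abs _
    change |(|x| - |f x| • u)| ≤ _
    rw [h]
    exact abs_abs_sub_abs_le _ _

end Preliminaries

/-! ### Unital homomorphisms preserve order and lattice operations. -/

section Homs

variable {E : Type*} [AddCommGroup E] [Lattice E] [IsOrderedAddMonoid E] [Module ℝ E]
  [IsOrderedModule ℝ E] {u : E} {φ : E →ₗ[ℝ] ℝ}

theorem IsUnitalHom.map_nonneg (hφ : IsUnitalHom u φ) {x : E} (hx : 0 ≤ x) : 0 ≤ φ x := by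
  rw [← abs_of_nonneg hx, hφ.map_abs]
  exact abs_nonneg _

theorem IsUnitalHom.mono (hφ : IsUnitalHom u φ) {x y : E} (h : x ≤ y) : φ x ≤ φ y := by
  simpa using hφ.map_nonneg (sub_nonneg.2 h)

theorem IsUnitalHom.map_sup (hφ : IsUnitalHom u φ) (x y : E) : φ (x ⊔ y) = φ x ⊔ φ y := by
  rw [sup_eq_half_smul_add_add_abs_sub' ℝ x y, sup_eq_half_smul_add_add_abs_sub' ℝ (φ x) (φ y)]
  simp [hφ.map_abs, mul_add]

theorem IsUnitalHom.map_inf (hφ : IsUnitalHom u φ) (x y : E) : φ (x ⊓ y) = φ x ⊓ φ y := by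
  rw [inf_eq_half_smul_add_sub_abs_sub' ℝ x y, inf_eq_half_smul_add_sub_abs_sub' ℝ (φ x) (φ y)]
  simp [hφ.map_abs]

theorem IsUnitalHom.map_posPart (hφ : IsUnitalHom u φ) (x : E) : φ x⁺ = (φ x)⁺ := by
  rw [posPart_def, posPart_def, hφ.map_sup, map_zero]

end Homs

/-! ### Archimedean property and separation by unital homomorphisms. -/

section Separation

variable {E : Type*} [AddCommGroup E] [ConditionallyCompleteLattice E] [IsOrderedAddMonoid E]
  [Module ℝ E] [IsOrderedModule ℝ E] {u : E}

/-- The supremum `s` of the multiples satisfies `s ≤ s - x`. -/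
theorem nonpos_of_forall_nsmul_le {x y : E} (h : ∀ n : ℕ, n • x ≤ y) : x ≤ 0 := by
  have hb : BddAbove (Set.range fun n : ℕ => n • x) := ⟨y, by rintro _ ⟨n, rfl⟩; exact h n⟩
  have h1 : (⨆ n : ℕ, n • x) ≤ (⨆ n : ℕ, n • x) - x := ciSup_le fun n => by
    rw [le_sub_iff_add_le, ← succ_nsmul]
    exact le_ciSup hb (n + 1)
  simpa using h1

theorem nonpos_of_forall_le_smul {x y : E} (h : ∀ ε : ℝ, 0 < ε → x ≤ ε • y) : x ≤ 0 := by
  refine nonpos_of_forall_nsmul_le (y := 0 ⊔ y) fun n => ?_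
  rcases Nat.eq_zero_or_pos n with rfl | hn
  · simp
  · have hn' : (0 : ℝ) < n := by exact_mod_cast hn
    have := smul_le_smul_of_nonneg_left (h (n : ℝ)⁻¹ (inv_pos.2 hn')) hn'.le
    rw [smul_inv_smul₀ hn'.ne', Nat.cast_smul_eq_nsmul] at this
    exact this.trans le_sup_right

/-- If `x + ε • u` had a nonzero negative part, the ideal generated by its positive part `a` would
be proper: `u ≤ r • a` would bound the negative part by a multiple of the disjoint `a`. A `φ`
vanishing on `a` then has `φ x ≤ -ε`. -/
theorem nonneg_of_forall_unitalHom (hu : IsStrongUnit u) {x : E}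
    (h : ∀ φ : E →ₗ[ℝ] ℝ, IsUnitalHom u φ → 0 ≤ φ x) : 0 ≤ x := by
  rw [← neg_nonpos]
  refine nonpos_of_forall_le_smul (y := u) fun ε hε => ?_
  rw [neg_le_iff_add_nonneg', ← negPart_eq_zero]
  by_contra hne
  set a := (x + ε • u)⁺ with ha
  have hbot : IsOrderIdeal (⊥ : Submodule ℝ E) := by
    intro x y hx hyx
    rw [(Submodule.mem_bot ℝ).1 hx, abs_zero] at hyx
    have := le_antisymm hyx (abs_nonneg y)
    exact (Submodule.mem_bot ℝ).2 (le_antisymm (this ▸ le_abs_self y) (neg_nonpos.1 (this ▸ neg_le_abs y)))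
  have hproper : adjoin ⊥ a ∈ properIdeals u := by
    refine ⟨isOrderIdeal_adjoin _ _, ?_⟩
    rintro ⟨i, hi, -, r, hr, hle⟩
    rw [(Submodule.mem_bot ℝ).1 hi, zero_add, abs_of_nonneg hu.nonneg] at hle
    obtain ⟨c, hc⟩ := hu.dominates ((x + ε • u)⁻)
    rw [abs_of_nonneg (negPart_nonneg _)] at hc
    have hc' : (x + ε • u)⁻ ≤ (|c| * r) • a := by
      refine hc.trans ((smul_le_smul_of_nonneg_right (le_abs_self c) hu.nonneg).trans ?_)
      rw [mul_smul]
      exact smul_le_smul_of_nonneg_left hle (abs_nonneg c)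
    have h0 := smul_inf_smul_eq_zero (posPart_inf_negPart_eq_zero (x + ε • u))
      (mul_nonneg (abs_nonneg c) hr) zero_le_one
    rw [one_smul, ← ha, inf_eq_right.2 hc'] at h0
    exact hne h0
  obtain ⟨M, hle, hM⟩ := exists_maximal_ideal hproper
  obtain ⟨φ, hφ, hφM⟩ := exists_unitalHom_of_maximal hu hM
  have haM : a ∈ M := hle (mem_adjoin_self _ (posPart_nonneg _))
  have h0 : φ a = 0 := by
    by_contra hne
    have h1 := M.sub_mem haM (hφM a)
    rw [sub_sub_cancel] at h1
    exact hM.1.2 (by simpa [smul_smul, hne] using M.smul_mem (φ a)⁻¹ h1)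
  have h1 := h φ hφ
  have h2 := hφ.mono (le_posPart (x + ε • u))
  rw [← ha, h0, map_add, map_smul, hφ.map_unit, smul_eq_mul, mul_one] at h2
  linarith

theorem le_of_forall_unitalHom (hu : IsStrongUnit u) {x y : E}
    (h : ∀ φ : E →ₗ[ℝ] ℝ, IsUnitalHom u φ → φ x ≤ φ y) : x ≤ y :=
  sub_nonneg.1 <| nonneg_of_forall_unitalHom hu fun φ hφ => by
    rw [map_sub]
    exact sub_nonneg.2 (h φ hφ)

theorem eq_of_forall_unitalHom (hu : IsStrongUnit u) {x y : E}
    (h : ∀ φ : E →ₗ[ℝ] ℝ, IsUnitalHom u φ → φ x = φ y) : x = y :=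
  le_antisymm (le_of_forall_unitalHom hu fun φ hφ => (h φ hφ).le)
    (le_of_forall_unitalHom hu fun φ hφ => (h φ hφ).ge)

end Separation

/-! ### Continuous functional calculus. -/

section FunctionalCalculus

variable {E : Type*} [AddCommGroup E] [ConditionallyCompleteLattice E] [IsOrderedAddMonoid E]
  [Module ℝ E] [IsOrderedModule ℝ E] {u : E}

theorem IsUnitalHom.abs_apply_le {φ : E →ₗ[ℝ] ℝ} (hφ : IsUnitalHom u φ) {x : E} {c : ℝ}
    (h : |x| ≤ c • u) : |φ x| ≤ c := by
  rw [← hφ.map_abs]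
  simpa [hφ.map_unit] using hφ.mono h

/-- A function on the unital homomorphisms that is uniformly approximable by elements of the
Riesz space is represented by an element. -/
theorem exists_of_forall_approx (hu : IsStrongUnit u) (g : (E →ₗ[ℝ] ℝ) → ℝ)
    (h : ∀ ε : ℝ, 0 < ε → ∃ y : E, ∀ φ, IsUnitalHom u φ → |φ y - g φ| ≤ ε) :
    ∃ y : E, ∀ φ, IsUnitalHom u φ → φ y = g φ := by
  set S : Set E := {z | ∀ φ, IsUnitalHom u φ → φ z ≤ g φ}
  -- An `ε`-approximant `y` traps `sSup S` between `y - ε • u` and `y + ε • u`.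
  have hlower : ∀ ε : ℝ, ∀ y : E, (∀ φ, IsUnitalHom u φ → |φ y - g φ| ≤ ε) → y - ε • u ∈ S := by
    intro ε y hy φ hφ
    have := (abs_le.1 (hy φ hφ)).2
    simp only [map_sub, map_smul, hφ.map_unit, smul_eq_mul]
    linarith
  have hupper : ∀ ε : ℝ, ∀ y : E, (∀ φ, IsUnitalHom u φ → |φ y - g φ| ≤ ε) →
      ∀ z ∈ S, z ≤ y + ε • u := by
    intro ε y hy z hz
    refine le_of_forall_unitalHom hu fun φ hφ => ?_
    have := (abs_le.1 (hy φ hφ)).1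
    have := hz φ hφ
    simp only [map_add, map_smul, hφ.map_unit, smul_eq_mul]
    linarith
  obtain ⟨y₁, hy₁⟩ := h 1 one_pos
  have hne : S.Nonempty := ⟨_, hlower 1 y₁ hy₁⟩
  have hbdd : BddAbove S := ⟨_, hupper 1 y₁ hy₁⟩
  refine ⟨sSup S, fun φ hφ => ?_⟩
  have key : ∀ ε : ℝ, 0 < ε → |φ (sSup S) - g φ| ≤ 2 * ε := by
    intro ε hε
    obtain ⟨y, hy⟩ := h ε hε
    have h1 := hφ.mono (le_csSup hbdd (hlower ε y hy))
    have h2 := hφ.mono (csSup_le hne (hupper ε y hy))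
    have h3 := abs_le.1 (hy φ hφ)
    simp only [map_add, map_sub, map_smul, hφ.map_unit, smul_eq_mul] at h1 h2
    exact abs_le.2 ⟨by linarith, by linarith⟩
  refine eq_of_abs_sub_nonpos (le_of_forall_pos_le_add fun ε hε => ?_)
  have := key (ε / 2) (half_pos hε)
  linarith

theorem exists_map_eq_comp (hu : IsStrongUnit u) (x : E) {f : ℝ → ℝ} (hf : Continuous f) :
    ∃ y : E, ∀ φ : E →ₗ[ℝ] ℝ, IsUnitalHom u φ → φ y = f (φ x) := by
  obtain ⟨c, hc⟩ := hu.dominates x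
  have hmem : ∀ φ : E →ₗ[ℝ] ℝ, IsUnitalHom u φ → φ x ∈ Set.Icc (-c) c := fun φ hφ =>
    abs_le.1 (hφ.abs_apply_le hc)
  set K := Set.Icc (-c) c
  set L : Set C(K, ℝ) :=
    {g | ∃ y : E, ∀ φ, ∀ hφ : IsUnitalHom u φ, φ y = g ⟨φ x, hmem φ hφ⟩}
  have hL : closure L = ⊤ := by
    refine ContinuousMap.sublattice_closure_eq_top L ⟨0, 0, fun φ _ => by simp⟩ ?_ ?_ ?_
    · rintro g ⟨y, hy⟩ k ⟨z, hz⟩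
      exact ⟨y ⊓ z, fun φ hφ => by rw [hφ.map_inf, hy φ hφ, hz φ hφ]; rfl⟩
    · rintro g ⟨y, hy⟩ k ⟨z, hz⟩
      exact ⟨y ⊔ z, fun φ hφ => by rw [hφ.map_sup, hy φ hφ, hz φ hφ]; rfl⟩
    · intro v a b
      rcases eq_or_ne a b with rfl | hab
      · exact ⟨ContinuousMap.const K (v a), ⟨v a • u, fun φ hφ => by simp [hφ.map_unit]⟩, rfl, rfl⟩
      -- The affine function through both prescribed values is represented by a combination of `u`
      -- and `x`.
      · have hab' : (b : ℝ) - a ≠ 0 := sub_ne_zero.2 fun h => hab (Subtype.ext h.symm)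
        set r := (v b - v a) / ((b : ℝ) - a) with hr
        refine ⟨⟨fun t => v a + r * (t - a), by fun_prop⟩,
          ⟨v a • u + r • (x - (a : ℝ) • u), fun φ hφ => by simp [hφ.map_unit]⟩, by simp, ?_⟩
        simp [hr, hab']
  refine exists_of_forall_approx hu (fun φ => f (φ x)) fun ε hε => ?_
  have hfL : (⟨fun t => f t, by fun_prop⟩ : C(K, ℝ)) ∈ closure L := hL ▸ trivial
  obtain ⟨g, ⟨y, hy⟩, hg⟩ := Metric.mem_closure_iff.1 hfL ε hε
  refine ⟨y, fun φ hφ => ?_⟩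
  rw [hy φ hφ, ← Real.dist_eq, dist_comm]
  exact (ContinuousMap.dist_apply_le_dist ⟨φ x, hmem φ hφ⟩).trans hg.le

theorem exists_map_eq_mul (hu : IsStrongUnit u) (x y : E) :
    ∃ z : E, ∀ φ : E →ₗ[ℝ] ℝ, IsUnitalHom u φ → φ z = φ x * φ y := by
  have hsq : ∀ x : E, ∃ z : E, ∀ φ : E →ₗ[ℝ] ℝ, IsUnitalHom u φ → φ z = φ x ^ 2 := fun x =>
    exists_map_eq_comp hu x (by fun_prop : Continuous fun t : ℝ => t ^ 2)
  choose q hq using hsq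
  refine ⟨(2 : ℝ)⁻¹ • (q (x + y) - q x - q y), fun φ hφ => ?_⟩
  simp only [map_smul, map_sub, hq _ φ hφ, map_add, smul_eq_mul]
  ring

end FunctionalCalculus

/-! ### Existence and uniqueness of the product. -/

section Multiplication

variable {E : Type*} [AddCommGroup E] [ConditionallyCompleteLattice E] [IsOrderedAddMonoid E]
  [Module ℝ E] [IsOrderedModule ℝ E] {u : E}

/-- The kernel of `φ` absorbs products: for `b ≥ 0` and `|y| ≤ c • u`, positivity gives `-c • b ≤ m
b y ≤ c • b`. Apply this to `x - φ x • u`. -/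
theorem IsUnitalFAlgebraMul.map_mul {m : E →ₗ[ℝ] E →ₗ[ℝ] E} (hm : IsUnitalFAlgebraMul u m)
    (hu : IsStrongUnit u) {φ : E →ₗ[ℝ] ℝ} (hφ : IsUnitalHom u φ) (x y : E) :
    φ (m x y) = φ x * φ y := by
  have key : ∀ a : E, φ a = 0 → φ (m a y) = 0 := by
    intro a ha
    obtain ⟨c, hc⟩ := hu.dominates y
    have hpos : ∀ b : E, 0 ≤ b → φ b = 0 → φ (m b y) = 0 := by
      intro b hb hb0
      have h1 : m b y ≤ c • b := by
        have := hm.mul_nonneg b _ hb (sub_nonneg.2 ((le_abs_self y).trans hc))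
        rwa [map_sub, map_smul, hm.mul_unit, sub_nonneg] at this
      have h2 : -(c • b) ≤ m b y := by
        have := hm.mul_nonneg b _ hb (neg_le_iff_add_nonneg.1 (neg_le.1 ((neg_le_abs y).trans hc)))
        rw [map_add, map_smul, hm.mul_unit] at this
        exact neg_le_iff_add_nonneg.2 this
      have h3 := hφ.mono h1
      have h4 := hφ.mono h2
      simp only [map_neg, map_smul, hb0, smul_zero, neg_zero] at h3 h4
      exact le_antisymm h3 h4
    have h1 := hpos a⁺ (posPart_nonneg a) (by rw [hφ.map_posPart, ha, posPart_zero])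
    have h2 := hpos a⁻ (negPart_nonneg a) (by
      rw [← posPart_neg, hφ.map_posPart, map_neg, ha, neg_zero, posPart_zero])
    rw [← posPart_sub_negPart a, map_sub, LinearMap.sub_apply, map_sub, h1, h2, sub_zero]
  have h := key (x - φ x • u) (by simp [hφ.map_unit])
  rw [map_sub, map_smul, LinearMap.sub_apply, LinearMap.smul_apply, hm.unit_mul, map_sub, map_smul,
    smul_eq_mul] at h
  linarith

theorem existsUnique_isUnitalFAlgebraMul (hu : IsStrongUnit u) :
    ∃! m : E →ₗ[ℝ] E →ₗ[ℝ] E, IsUnitalFAlgebraMul u m := by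
  choose p hp using exists_map_eq_mul hu (E := E)
  have hdisj : ∀ x y c z : E, x ⊓ y = 0 → 0 ≤ c →
      (∀ φ, IsUnitalHom u φ → φ z = φ c * φ x) → z ⊓ y = 0 := by
    intro x y c z hxy hc hz
    refine eq_of_forall_unitalHom hu fun φ hφ => ?_
    have h1 := congrArg φ hxy
    rw [hφ.map_inf, map_zero] at h1
    rw [hφ.map_inf, map_zero, hz φ hφ]
    have hx : 0 ≤ φ x := h1 ▸ inf_le_left
    have hy : 0 ≤ φ y := h1 ▸ inf_le_right
    have hc' := hφ.map_nonneg hc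
    rcases le_total (φ x) (φ y) with h | h
    · rw [inf_eq_left.2 h] at h1
      rw [h1, mul_zero, inf_eq_left.2 hy]
    · rw [inf_eq_right.2 h] at h1
      rw [h1, inf_eq_right.2 (mul_nonneg hc' hx)]
  refine ⟨LinearMap.mk₂ ℝ p ?_ ?_ ?_ ?_, ⟨?_, ?_, ?_, ?_, ?_, ?_⟩, ?_⟩
  · exact fun x x' y => eq_of_forall_unitalHom hu fun φ hφ => by
      simp only [hp _ _ φ hφ, map_add]; ring
  · exact fun c x y => eq_of_forall_unitalHom hu fun φ hφ => by
      simp only [hp _ _ φ hφ, map_smul, smul_eq_mul]; ring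
  · exact fun x y y' => eq_of_forall_unitalHom hu fun φ hφ => by
      simp only [hp _ _ φ hφ, map_add]; ring
  · exact fun c x y => eq_of_forall_unitalHom hu fun φ hφ => by
      simp only [hp _ _ φ hφ, map_smul, smul_eq_mul]; ring
  · exact fun x y z => eq_of_forall_unitalHom hu fun φ hφ => by
      simp only [LinearMap.mk₂_apply, hp _ _ φ hφ, mul_assoc]
  · exact fun x => eq_of_forall_unitalHom hu fun φ hφ => by
      simp only [LinearMap.mk₂_apply, hp _ _ φ hφ, hφ.map_unit, one_mul]
  · exact fun x => eq_of_forall_unitalHom hu fun φ hφ => by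
      simp only [LinearMap.mk₂_apply, hp _ _ φ hφ, hφ.map_unit, mul_one]
  · exact fun x y hx hy => nonneg_of_forall_unitalHom hu fun φ hφ => by
      simpa only [LinearMap.mk₂_apply, hp _ _ φ hφ] using
        mul_nonneg (hφ.map_nonneg hx) (hφ.map_nonneg hy)
  · exact fun x y c hxy hc => hdisj x y c _ hxy hc fun φ hφ => hp _ _ φ hφ
  · exact fun x y c hxy hc => hdisj x y c _ hxy hc fun φ hφ => (hp _ _ φ hφ).trans (mul_comm _ _)
  · intro m hm
    ext x y
    exact eq_of_forall_unitalHom hu fun φ hφ => by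
      rw [hm.map_mul hu hφ, LinearMap.mk₂_apply, hp _ _ φ hφ]

end Multiplication

/-! ### Order convergence and the exponential. -/

section Exponential

variable {E : Type*} [AddCommGroup E] [ConditionallyCompleteLattice E] [IsOrderedAddMonoid E]
  [Module ℝ E] [IsOrderedModule ℝ E] {u : E}

theorem OrderTendsto.unique {s : ℕ → E} {a b : E} (ha : OrderTendsto s a) (hb : OrderTendsto s b) :
    a = b := by
  obtain ⟨p, hp, hp0, hpa⟩ := ha
  obtain ⟨q, hq, hq0, hqb⟩ := hb
  have h : ∀ n m, |a - b| ≤ p n + q m := fun n m => by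
    calc |a - b| ≤ |a - s (max n m)| + |s (max n m) - b| := by
            simpa using abs_add_le (a - s (max n m)) (s (max n m) - b)
      _ ≤ p (max n m) + q (max n m) := add_le_add (abs_sub_comm a _ ▸ hpa _) (hqb _)
      _ ≤ p n + q m := add_le_add (hp (le_max_left n m)) (hq (le_max_right n m))
  have h1 : ∀ m, |a - b| ≤ q m := fun m => by
    refine sub_nonpos.1 (hp0.2 ?_)
    rintro _ ⟨n, rfl⟩
    exact sub_le_iff_le_add.2 (h n m)
  have h2 : |a - b| ≤ 0 := hq0.2 (by rintro _ ⟨m, rfl⟩; exact h1 m)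
  refine le_antisymm (sub_nonpos.1 ((le_abs_self _).trans h2)) (sub_nonpos.1 ?_)
  rw [← neg_sub]
  exact (neg_le_abs _).trans h2

theorem orderTendsto_of_forall_abs_le {s : ℕ → E} {a : E} (hu : 0 ≤ u) {ε : ℕ → ℝ}
    (hanti : Antitone ε) (hlim : Filter.Tendsto ε Filter.atTop (nhds 0))
    (h : ∀ n, |s n - a| ≤ ε n • u) : OrderTendsto s a := by
  have hε : ∀ n, 0 ≤ ε n := hanti.le_of_tendsto hlim
  refine ⟨fun n => ε n • u, fun n m hnm => smul_le_smul_of_nonneg_right (hanti hnm) hu, ⟨?_, ?_⟩, h⟩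
  · rintro _ ⟨n, rfl⟩
    exact smul_nonneg (hε n) hu
  · intro b hb
    refine nonpos_of_forall_le_smul (y := u) fun δ hδ => ?_
    obtain ⟨n, hn⟩ := (hlim.eventually (gt_mem_nhds hδ)).exists
    exact (hb ⟨n, rfl⟩).trans (smul_le_smul_of_nonneg_right hn.le hu)

/-- The tail at `t` is dominated termwise by the tail at `c`, giving an error bound uniform over all
`φ`. -/
theorem abs_sum_sub_exp_le {t c : ℝ} (h : |t| ≤ c) (n : ℕ) :
    |∑ k ∈ Finset.range n, (k.factorial : ℝ)⁻¹ * t ^ k - Real.exp t| ≤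
      Real.exp c - ∑ k ∈ Finset.range n, (k.factorial : ℝ)⁻¹ * c ^ k := by
  have hs : ∀ r : ℝ, HasSum (fun k : ℕ => (k.factorial : ℝ)⁻¹ * r ^ k) (Real.exp r) := fun r => by
    simpa [Real.exp_eq_exp_ℝ] using NormedSpace.exp_series_hasSum_exp' (𝕂 := ℝ) r
  have htail := fun r : ℝ => (hasSum_nat_add_iff' n).2 (hs r)
  rw [abs_sub_comm, ← (htail t).tsum_eq, ← Real.norm_eq_abs]
  refine tsum_of_norm_bounded (htail c) fun k => ?_
  rw [norm_mul, norm_pow, Real.norm_eq_abs, Real.norm_eq_abs, abs_of_nonneg (by positivity)]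
  gcongr

variable {m : E →ₗ[ℝ] E →ₗ[ℝ] E}

theorem IsUnitalFAlgebraMul.map_pow (hm : IsUnitalFAlgebraMul u m) (hu : IsStrongUnit u)
    {φ : E →ₗ[ℝ] ℝ} (hφ : IsUnitalHom u φ) (x : E) (n : ℕ) : φ (pow u m x n) = φ x ^ n := by
  induction n with
  | zero => rw [pow, hφ.map_unit, pow_zero]
  | succ n ih => rw [pow, hm.map_mul hu hφ, ih, pow_succ']

theorem IsUnitalFAlgebraMul.map_expPartialSum (hm : IsUnitalFAlgebraMul u m) (hu : IsStrongUnit u)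
    {φ : E →ₗ[ℝ] ℝ} (hφ : IsUnitalHom u φ) (x : E) (n : ℕ) :
    φ (expPartialSum u m x n) =
      ∑ k ∈ Finset.range (n + 1), (k.factorial : ℝ)⁻¹ * φ x ^ k := by
  simp [expPartialSum, hm.map_pow hu hφ]

theorem IsUnitalFAlgebraMul.exists_orderTendsto (hm : IsUnitalFAlgebraMul u m)
    (hu : IsStrongUnit u) (x : E) : ∃ e : E, OrderTendsto (expPartialSum u m x) e ∧
      ∀ φ, IsUnitalHom u φ → φ e = Real.exp (φ x) := by
  obtain ⟨e, he⟩ := exists_map_eq_comp hu x Real.continuous_exp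
  obtain ⟨c, hc⟩ := hu.dominates x
  -- Replacing `c` by `|c|` keeps the series terms nonnegative, so its tails decrease.
  have hc' : |x| ≤ |c| • u := hc.trans (smul_le_smul_of_nonneg_right (le_abs_self c) hu.nonneg)
  refine ⟨e, orderTendsto_of_forall_abs_le hu.nonneg
    (ε := fun n => Real.exp |c| - ∑ k ∈ Finset.range (n + 1), (k.factorial : ℝ)⁻¹ * |c| ^ k)
    ?_ ?_ fun n => ?_, he⟩
  · refine antitone_nat_of_succ_le fun n => ?_
    rw [Finset.sum_range_succ _ (n + 1)]
    have : 0 ≤ ((n + 1).factorial : ℝ)⁻¹ * |c| ^ (n + 1) := by positivity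
    linarith
  · have h : HasSum (fun k : ℕ => (k.factorial : ℝ)⁻¹ * |c| ^ k) (Real.exp |c|) := by
      simpa [Real.exp_eq_exp_ℝ] using NormedSpace.exp_series_hasSum_exp' (𝕂 := ℝ) |c|
    simpa using ((Filter.tendsto_add_atTop_iff_nat 1).2 h.tendsto_sum_nat).const_sub (Real.exp |c|)
  · refine le_of_forall_unitalHom hu fun φ hφ => ?_
    rw [hφ.map_abs, map_sub, hm.map_expPartialSum hu hφ, he φ hφ, map_smul, hφ.map_unit,
      smul_eq_mul, mul_one]
    exact abs_sum_sub_exp_le (hφ.abs_apply_le hc') (n + 1)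

theorem IsUnitalFAlgebraMul.orderTendsto_exp (hm : IsUnitalFAlgebraMul u m)
    (hu : IsStrongUnit u) (x : E) : OrderTendsto (expPartialSum u m x) (exp u m x) := by
  have h : ∃ e : E, OrderTendsto (expPartialSum u m x) e :=
    (hm.exists_orderTendsto hu x).imp fun _ => And.left
  rw [exp, dif_pos h]
  exact h.choose_spec

theorem IsUnitalFAlgebraMul.map_exp (hm : IsUnitalFAlgebraMul u m) (hu : IsStrongUnit u)
    {φ : E →ₗ[ℝ] ℝ} (hφ : IsUnitalHom u φ) (x : E) : φ (exp u m x) = Real.exp (φ x) := by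
  obtain ⟨e, he, hmap⟩ := hm.exists_orderTendsto hu x
  rw [(hm.orderTendsto_exp hu x).unique he, hmap φ hφ]

theorem continuous_dslope_exp : Continuous (dslope Real.exp 0) := by
  rw [← continuousOn_univ, continuousOn_dslope Filter.univ_mem]
  exact ⟨Real.continuous_exp.continuousOn, Real.differentiableAt_exp⟩

theorem dslope_exp_pos (t : ℝ) : 0 < dslope Real.exp 0 t := by
  rcases eq_or_ne t 0 with rfl | ht
  · simp [dslope_same]
  · rw [dslope_of_ne _ ht]
    rw [slope_def_field]
    rcases ht.lt_or_gt with h | h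
    · exact div_pos_of_neg_of_neg (sub_neg.2 (Real.exp_lt_exp.2 h)) (sub_neg.2 h)
    · exact div_pos (sub_pos.2 (Real.exp_lt_exp.2 h)) (sub_pos.2 h)

/-- The factor is `exp y · D(x - y)` with `D = dslope Real.exp 0`; its inverse is `exp (-y) · D⁻¹(x
- y)`. Positivity of the inverse is recorded for the comparison of bands. -/
theorem IsUnitalFAlgebraMul.exp_sub_exp (hm : IsUnitalFAlgebraMul u m) (hu : IsStrongUnit u)
    (x y : E) : ∃ z : E, 0 ≤ z ∧ (∃ w : E, 0 ≤ w ∧ m z w = u ∧ m w z = u) ∧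
      exp u m x - exp u m y = m z (x - y) := by
  obtain ⟨h, hh⟩ := exists_map_eq_comp hu (x - y) continuous_dslope_exp
  obtain ⟨k, hk⟩ := exists_map_eq_comp hu (x - y)
    (continuous_dslope_exp.inv₀ fun t => (dslope_exp_pos t).ne')
  have hz : ∀ φ, IsUnitalHom u φ →
      φ (m (exp u m y) h) = Real.exp (φ y) * dslope Real.exp 0 (φ (x - y)) := fun φ hφ => by
    rw [hm.map_mul hu hφ, hm.map_exp hu hφ, hh φ hφ]
  have hw : ∀ φ, IsUnitalHom u φ →
      φ (m (exp u m (-y)) k) = (Real.exp (φ y))⁻¹ * (dslope Real.exp 0 (φ (x - y)))⁻¹ :=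
    fun φ hφ => by rw [hm.map_mul hu hφ, hm.map_exp hu hφ, hk φ hφ, map_neg, Real.exp_neg,
      Pi.inv_apply]
  refine ⟨m (exp u m y) h, nonneg_of_forall_unitalHom hu fun φ hφ => ?_,
    ⟨m (exp u m (-y)) k, nonneg_of_forall_unitalHom hu fun φ hφ => ?_,
      eq_of_forall_unitalHom hu fun φ hφ => ?_, eq_of_forall_unitalHom hu fun φ hφ => ?_⟩,
    eq_of_forall_unitalHom hu fun φ hφ => ?_⟩
  · rw [hz φ hφ]
    exact _root_.mul_nonneg (Real.exp_pos _).le (dslope_exp_pos _).le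
  · rw [hw φ hφ]
    exact _root_.mul_nonneg (inv_nonneg.2 (Real.exp_pos _).le) (inv_nonneg.2 (dslope_exp_pos _).le)
  · have := (dslope_exp_pos (φ (x - y))).ne'
    rw [hm.map_mul hu hφ, hz φ hφ, hw φ hφ, hφ.map_unit]
    field_simp
  · have := (dslope_exp_pos (φ (x - y))).ne'
    rw [hm.map_mul hu hφ, hz φ hφ, hw φ hφ, hφ.map_unit]
    field_simp
  · have := sub_smul_dslope Real.exp 0 (φ (x - y))
    rw [sub_zero, smul_eq_mul, Real.exp_zero] at this
    rw [map_sub, hm.map_exp hu hφ, hm.map_exp hu hφ, hm.map_mul hu hφ, hz φ hφ, mul_assoc,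
      mul_comm (dslope _ _ _), this, mul_sub, ← Real.exp_add, map_sub]
    simp

end Exponential

/-! ### Bands and projections. -/

section Bands

variable {E : Type*} [AddCommGroup E] [ConditionallyCompleteLattice E] [IsOrderedAddMonoid E]
  [Module ℝ E] [IsOrderedModule ℝ E] {u : E}

theorem isBand_bandGenerated (w : E) : IsBand (bandGenerated w) where
  solid _ _ hx hyx := (Submodule.mem_sInf).2 fun B hB =>
    hB.1.solid ((Submodule.mem_sInf).1 hx B hB) hyx
  isLUB_mem _ _ hS ha := (Submodule.mem_sInf).2 fun B hB =>
    hB.1.isLUB_mem (fun _ hs => (Submodule.mem_sInf).1 (hS hs) B hB) ha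

theorem self_mem_bandGenerated (w : E) : w ∈ bandGenerated w :=
  (Submodule.mem_sInf).2 fun _ hB => hB.2

theorem bandGenerated_le {v w : E} (hv : 0 ≤ v) {c : ℝ} (h : v ≤ c • w) :
    bandGenerated v ≤ bandGenerated w := by
  refine sInf_le ⟨isBand_bandGenerated w, (isBand_bandGenerated w).solid
    (Submodule.smul_mem _ c (self_mem_bandGenerated w)) ?_⟩
  rw [abs_of_nonneg hv]
  exact h.trans (le_abs_self _)

theorem IsBand.isProjectionBand {B : Submodule ℝ E} (hB : IsBand B) : IsProjectionBand B := by
  have hpos : ∀ x : E, 0 ≤ x → ∃ y ∈ B, ∃ z : E, 0 ≤ z ∧ (∀ b ∈ B, z ⊓ |b| = 0) ∧ x = y + z := by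
    intro x hx
    set S : Set E := {b | b ∈ B ∧ b ≤ x}
    have hne : S.Nonempty := ⟨0, B.zero_mem, hx⟩
    have hbdd : BddAbove S := ⟨x, fun b hb => hb.2⟩
    have hlub := isLUB_csSup hne hbdd
    have hyx : sSup S ≤ x := csSup_le hne fun b hb => hb.2
    have hyB : sSup S ∈ B := hB.isLUB_mem (fun b hb => hb.1) hlub
    refine ⟨sSup S, hyB, x - sSup S, sub_nonneg.2 hyx, fun b hb => ?_, by abel⟩
    have h0 : 0 ≤ (x - sSup S) ⊓ |b| := le_inf (sub_nonneg.2 hyx) (abs_nonneg b)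
    have hcB : (x - sSup S) ⊓ |b| ∈ B := hB.solid hb (by
      rw [abs_of_nonneg h0]
      exact inf_le_right)
    refine le_antisymm ?_ h0
    -- Adding the common part stays in `B` and below `x`, so maximality of the supremum makes it
    -- zero.
    have h1 : sSup S + (x - sSup S) ⊓ |b| ∈ S := by
      refine ⟨B.add_mem hyB hcB, (add_le_add_right inf_le_left _).trans_eq ?_⟩
      abel
    simpa using le_csSup hbdd h1
  refine ⟨hB, fun x => ?_⟩
  obtain ⟨y₁, hy₁, z₁, hz₁, hd₁, h₁⟩ := hpos x⁺ (posPart_nonneg x)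
  obtain ⟨y₂, hy₂, z₂, hz₂, hd₂, h₂⟩ := hpos x⁻ (negPart_nonneg x)
  refine ⟨y₁ - y₂, B.sub_mem hy₁ hy₂, z₁ - z₂, fun b hb => ?_, ?_⟩
  · refine le_antisymm ?_ (le_inf (abs_nonneg _) (abs_nonneg _))
    have h : |z₁ - z₂| ≤ z₁ + z₂ := by
      simpa [sub_eq_add_neg, abs_of_nonneg hz₁, abs_of_nonneg hz₂] using abs_add_le z₁ (-z₂)
    refine (inf_le_inf_right _ h).trans ((inf_add_le_add_inf hz₁ hz₂ (abs_nonneg b)).trans_eq ?_)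
    rw [hd₁ b hb, hd₂ b hb, add_zero]
  · rw [← posPart_sub_negPart x, h₁, h₂]
    abel

theorem IsUnitalFAlgebraMul.posPart_mul_le {m : E →ₗ[ℝ] E →ₗ[ℝ] E} (hm : IsUnitalFAlgebraMul u m)
    (hu : IsStrongUnit u) {z : E} (hz : 0 ≤ z) (x : E) : ∃ c : ℝ, (m z x)⁺ ≤ c • x⁺ := by
  obtain ⟨c, hc⟩ := hu.dominates z
  refine ⟨c, le_of_forall_unitalHom hu fun φ hφ => ?_⟩
  have h := (le_abs_self _).trans (hφ.abs_apply_le hc)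
  rw [map_smul, hφ.map_posPart, hφ.map_posPart, hm.map_mul hu hφ, smul_eq_mul]
  refine sup_le ((mul_le_mul_of_nonneg_left (le_posPart (φ x)) (hφ.map_nonneg hz)).trans
    (mul_le_mul_of_nonneg_right h (posPart_nonneg _)))
    (_root_.mul_nonneg ((hφ.map_nonneg hz).trans h) (posPart_nonneg _))

/-- Bounding `z` by a multiple of `u` gives one inclusion; the same bound for `w`, applied to `m z
x`, gives the other. -/
theorem IsUnitalFAlgebraMul.bandGenerated_posPart_mul {m : E →ₗ[ℝ] E →ₗ[ℝ] E}
    (hm : IsUnitalFAlgebraMul u m) (hu : IsStrongUnit u) {z w : E} (hz : 0 ≤ z) (hw : 0 ≤ w)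
    (hwz : m w z = u) (x : E) : bandGenerated (m z x)⁺ = bandGenerated x⁺ := by
  obtain ⟨c, hc⟩ := hm.posPart_mul_le hu hz x
  obtain ⟨d, hd⟩ := hm.posPart_mul_le hu hw (m z x)
  rw [← hm.assoc, hwz, hm.unit_mul] at hd
  exact le_antisymm (bandGenerated_le (posPart_nonneg _) hc) (bandGenerated_le (posPart_nonneg _) hd)

theorem bandGenerated_posPart_smul {c : ℝ} (hc : 0 < c) (hu : IsStrongUnit u) (x : E) :
    bandGenerated (c • x)⁺ = bandGenerated x⁺ := by
  have h : (c • x)⁺ = c • x⁺ := eq_of_forall_unitalHom hu fun φ hφ => by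
    rw [hφ.map_posPart, map_smul, map_smul, hφ.map_posPart, smul_eq_mul, smul_eq_mul, posPart_def,
      posPart_def]
    rw [mul_max_of_nonneg _ _ hc.le, mul_zero]
  refine le_antisymm (bandGenerated_le (posPart_nonneg _) h.le)
    (bandGenerated_le (c := c⁻¹) (posPart_nonneg _) ?_)
  rw [h, inv_smul_smul₀ hc.ne']

end Bands

end RieszSpace

theorem mainTheorem10 {E : Type*} [AddCommGroup E] [ConditionallyCompleteLattice E]
    [IsOrderedAddMonoid E] [Module ℝ E] [IsOrderedModule ℝ E]
    (u : E) (hu : RieszSpace.IsStrongUnit u) :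
    (∃! m : E →ₗ[ℝ] E →ₗ[ℝ] E, RieszSpace.IsUnitalFAlgebraMul u m) ∧
    ∀ m : E →ₗ[ℝ] E →ₗ[ℝ] E, RieszSpace.IsUnitalFAlgebraMul u m →
      (∀ x : E, RieszSpace.OrderTendsto (RieszSpace.expPartialSum u m x)
        (RieszSpace.exp u m x)) ∧
      (∀ x y : E, ∃ z : E, 0 ≤ z ∧ (∃ w : E, m z w = u ∧ m w z = u) ∧
        RieszSpace.exp u m x - RieszSpace.exp u m y = m z (x - y)) ∧
      (∀ x y : E, ∀ c : ℝ, 0 < c →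
        RieszSpace.IsProjectionBand (RieszSpace.bandGenerated (x - y)⁺) ∧
        RieszSpace.bandGenerated (x - y)⁺ =
          RieszSpace.bandGenerated
            (RieszSpace.exp u m (c • x) - RieszSpace.exp u m (c • y))⁺) := by
  refine ⟨RieszSpace.existsUnique_isUnitalFAlgebraMul hu, fun m hm =>
    ⟨hm.orderTendsto_exp hu, fun x y => ?_, fun x y c hc =>
      ⟨(RieszSpace.isBand_bandGenerated _).isProjectionBand, ?_⟩⟩⟩
  · obtain ⟨z, hz, ⟨w, -, hzw, hwz⟩, h⟩ := hm.exp_sub_exp hu x y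
    exact ⟨z, hz, ⟨w, hzw, hwz⟩, h⟩
  · obtain ⟨z, hz, ⟨w, hw, -, hwz⟩, h⟩ := hm.exp_sub_exp hu (c • x) (c • y)
    rw [h, hm.bandGenerated_posPart_mul hu hz hw hwz, ← smul_sub,
      RieszSpace.bandGenerated_posPart_smul hc hu]
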